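/- Let $\mathcal A$ and $\mathcal B$ be finite-dimensional $C^*$-algebras, and let $J\subseteq\mathcal A$ be a complex linear subspace that is self-adjoint ($a^*\in J$ for every $a\in J$) and positively generated ($J$ is the complex linear span of the positive elements of $\mathcal A$ that lie in $J$). Call a linear map $\Xi: J\to\mathcal B$ completely positive (cp) if, for every $k\in\mathbb N$, the map $\mathrm{id}_{M_k}\otimes\Xi: M_k(\mathbb C)\otimes J\to M_k(\mathbb C)\otimes\mathcal B$ sends every element of $M_k(\mathbb C)\otimes J$ that is positive in the $C^*$-algebra $M_k(\mathbb C)\otimes\mathcal A$ to a positive element of $M_k(\mathbb C)\otimes\mathcal B$. Then every cp map $\Xi: J\to\mathcal B$ extends to a cp map $\Phi:\mathcal A\to\mathcal B$, that is, there is a cp map $\Phi:\mathcal A\to\mathcal B$ with $\Phi(x)=\Xi(x)$ for all $x\in J$. -/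

import Mathlib

open scoped CStarAlgebra

/-- A complex subspace of a C⋆-algebra is self-adjoint if it is closed under the adjoint. -/
def Submodule.IsSelfAdjointSubspace {A : Type*} [CStarAlgebra A] (J : Submodule ℂ A) : Prop :=
  ∀ a ∈ J, star a ∈ J

/-- A complex subspace of a C⋆-algebra is positively generated if it is the complex linear span
of the positive elements that it contains. -/
def Submodule.IsPositivelyGenerated {A : Type*} [CStarAlgebra A] [PartialOrder A]
    (J : Submodule ℂ A) : Prop :=
  Submodule.span ℂ {a : A | a ∈ J ∧ 0 ≤ a} = J

/-- A linear map `Ξ : J → B` on a subspace `J` of a C⋆-algebra `A` is completely positive if, for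
every `k`, applying `Ξ` entrywise takes every `k × k` matrix with entries in `J` that is positive
in the C⋆-algebra `M_k(A) = M_k(ℂ) ⊗ A` to a positive element of `M_k(B) = M_k(ℂ) ⊗ B`. -/
def LinearMap.IsCompletelyPositiveOn {A B : Type*}
    [CStarAlgebra A] [PartialOrder A] [StarOrderedRing A]
    [CStarAlgebra B] [PartialOrder B] [StarOrderedRing B]
    {J : Submodule ℂ A} (Ξ : J →ₗ[ℂ] B) : Prop :=
  ∀ (k : ℕ) (M : CStarMatrix (Fin k) (Fin k) J),
    0 ≤ M.map (fun x : J => (x : A)) → 0 ≤ M.map (fun x : J => Ξ x)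

/-! A Choi-type correspondence turns the extension of maps into the extension of functionals. For a
faithful trace `τ` on `B` and a basis `b` orthonormal for `τ (x⋆ * y)`, `Ξ` defines `g X = ∑ i j, τ
(b i⋆ * Ξ (X i j) * b j)` on matrices over `J`, and complete positivity makes `g` positive.

The M. Riesz theorem extends `g` to a positive functional `G` on all matrices over `A`
(`exists_positive_extension`). `J` need not contain `1`; a sum `e` of positive generators replaces
it, since `e` dominates a positive multiple of a projection `P` with `P * x * P = x` on `J`.

Pairing with `τ` turns `G` back into a map. It agrees with `Ξ` on `J` by Parseval and the
faithfulness of `τ` (`mapOfFunctional_eq_of_extends`), and it is cp because traciality reduces the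
test sums to values of `G` at positive matrices (`mapOfFunctional_map_nonneg`). -/

section CompletelyPositiveExtension

open scoped ComplexOrder

/-! ### Finite spectra and the trace of left multiplication -/

section FiniteDimensionalSpectrum

variable {B : Type*}

theorem spectrum_lmul {K : Type*} [Field K] [Ring B] [Algebra K B] (x : B) :
    spectrum K (Algebra.lmul K B x) = spectrum K x := by
  ext μ
  rw [spectrum.mem_iff, spectrum.mem_iff, ← (Algebra.lmul K B).commutes, ← map_sub,
    Algebra.lmul_isUnit_iff]

theorem finite_spectrum_of_finiteDimensional {K : Type*} [Field K] [Ring B] [Algebra K B]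
    [FiniteDimensional K B] (x : B) : (spectrum K x).Finite := by
  rw [← spectrum_lmul]
  exact Module.End.finite_spectrum _

theorem finite_real_spectrum_of_finiteDimensional [Ring B] [Algebra ℂ B]
    [FiniteDimensional ℂ B] (x : B) : (spectrum ℝ x).Finite := by
  have h := finite_spectrum_of_finiteDimensional (K := ℂ) x
  rw [← spectrum.preimage_algebraMap ℂ]
  exact h.preimage (algebraMap ℝ ℂ).injective.injOn

theorem nonneg_of_mem_spectrum_complex [CStarAlgebra B] [PartialOrder B] [StarOrderedRing B]
    {x : B} (hx : 0 ≤ x) {μ : ℂ} (hμ : μ ∈ spectrum ℂ x) : 0 ≤ μ := by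
  have h := (IsSelfAdjoint.of_nonneg hx).spectrumRestricts
  obtain ⟨r, hr, rfl⟩ := h.algebraMap_image ▸ hμ
  simpa using spectrum_nonneg_of_nonneg hx hr

variable [CStarAlgebra B]

variable (B) in
/-- The trace of left multiplication on a finite-dimensional C⋆-algebra. -/
noncomputable def lmulTrace : B →ₗ[ℂ] ℂ :=
  LinearMap.trace ℂ B ∘ₗ (Algebra.lmul ℂ B).toLinearMap

theorem lmulTrace_apply (x : B) :
    lmulTrace B x = LinearMap.trace ℂ B (Algebra.lmul ℂ B x) := rfl

theorem lmulTrace_mul_comm (x y : B) : lmulTrace B (x * y) = lmulTrace B (y * x) := by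
  simp only [lmulTrace_apply, map_mul]
  exact LinearMap.trace_mul_comm ℂ _ _

variable [FiniteDimensional ℂ B]

theorem mem_spectrum_of_mem_roots_charpoly_lmul {x : B} {μ : ℂ}
    (hμ : μ ∈ (Algebra.lmul ℂ B x).charpoly.roots) : μ ∈ spectrum ℂ x := by
  rw [← spectrum_lmul, ← Module.End.hasEigenvalue_iff_mem_spectrum,
    Module.End.hasEigenvalue_iff_isRoot_charpoly]
  exact Polynomial.isRoot_of_mem_roots hμ

theorem mem_roots_charpoly_lmul_of_mem_spectrum {x : B} {μ : ℂ}
    (hμ : μ ∈ spectrum ℂ x) : μ ∈ (Algebra.lmul ℂ B x).charpoly.roots := by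
  rw [← spectrum_lmul, ← Module.End.hasEigenvalue_iff_mem_spectrum,
    Module.End.hasEigenvalue_iff_isRoot_charpoly] at hμ
  exact (Polynomial.mem_roots (LinearMap.charpoly_monic _).ne_zero).2 hμ

variable [PartialOrder B] [StarOrderedRing B]

theorem lmulTrace_nonneg {x : B} (hx : 0 ≤ x) : 0 ≤ lmulTrace B x := by
  rw [lmulTrace_apply, Module.End.trace_eq_sum_roots_charpoly_of_splits (IsAlgClosed.splits _)]
  exact Multiset.sum_nonneg fun μ hμ =>
    nonneg_of_mem_spectrum_complex hx (mem_spectrum_of_mem_roots_charpoly_lmul hμ)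

/-- The trace is a sum of nonnegative eigenvalues, so all of them vanish, and a normal element with
spectrum in `{0}` is zero. -/
theorem eq_zero_of_lmulTrace_eq_zero {x : B} (hx : 0 ≤ x) (h : lmulTrace B x = 0) : x = 0 := by
  rw [lmulTrace_apply, Module.End.trace_eq_sum_roots_charpoly_of_splits (IsAlgClosed.splits _)] at h
  have h0 := Multiset.all_zero_of_le_zero_le_of_sum_eq_zero (fun μ hμ =>
    nonneg_of_mem_spectrum_complex hx (mem_spectrum_of_mem_roots_charpoly_lmul hμ)) h
  refine CFC.eq_zero_of_spectrum_subset_zero (R := ℂ) (p := IsStarNormal) x (fun μ hμ =>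
    h0 μ (mem_roots_charpoly_lmul_of_mem_spectrum hμ)) (IsSelfAdjoint.of_nonneg hx).isStarNormal

variable (B) in
/-- The trace of left multiplication as a positive functional. -/
noncomputable def lmulTracePos : B →ₚ[ℂ] ℂ := .mk₀ (lmulTrace B) fun _ => lmulTrace_nonneg

end FiniteDimensionalSpectrum

/-- A finite-dimensional complex vector space with an inner product has an orthonormal basis. -/
theorem exists_orthonormal_of_core {V : Type*} [AddCommGroup V] [Module ℂ V]
    [FiniteDimensional ℂ V] (c : InnerProductSpace.Core ℂ V) :
    ∃ (n : ℕ) (b : Fin n → V), (∀ x, ∑ i, c.inner (b i) x • b i = x) ∧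
      ∀ T : V →ₗ[ℂ] V, LinearMap.trace ℂ V T = ∑ i, c.inner (b i) (T (b i)) := by
  let := c
  let : NormedAddCommGroup V := InnerProductSpace.Core.toNormedAddCommGroup (𝕜 := ℂ)
  let : InnerProductSpace ℂ V := InnerProductSpace.ofCore c.toCore
  let b := stdOrthonormalBasis ℂ V
  exact ⟨_, b, fun x => b.sum_repr' x, fun T => T.trace_eq_sum_inner b⟩

/-! ### Detecting positivity with a faithful functional -/

section Positivity

variable {C : Type*} [CStarAlgebra C] [PartialOrder C] [StarOrderedRing C]

/-- A positive functional is faithful if it vanishes at no nonzero positive element. -/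
def PositiveLinearMap.IsFaithful (τ : C →ₚ[ℂ] ℂ) : Prop := ∀ x, 0 ≤ x → τ x = 0 → x = 0

/-- Testing with `d = y⁻` gives `τ (-(y⁻)³) ≥ 0`, so faithfulness forces `(y⁻)³ = 0`. -/
theorem PositiveLinearMap.IsFaithful.nonneg_of_isSelfAdjoint {τ : C →ₚ[ℂ] ℂ} (hτ : τ.IsFaithful)
    {y : C} (hy : IsSelfAdjoint y) (h : ∀ d, 0 ≤ τ (star d * y * d)) : 0 ≤ y := by
  rw [← CFC.negPart_eq_zero_iff y hy]
  have hn : 0 ≤ y⁻ := CFC.negPart_nonneg y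
  have hs : star y⁻ = y⁻ := (IsSelfAdjoint.of_nonneg hn).star_eq
  have h3 : 0 ≤ y⁻ * y⁻ * y⁻ := by simpa [hs] using star_left_conjugate_nonneg hn y⁻
  have e : star y⁻ * y * y⁻ = -(y⁻ * y⁻ * y⁻) := by
    have e' : y⁻ * (y⁺ - y⁻) = -(y⁻ * y⁻) := by
      rw [mul_sub, CFC.negPart_mul_posPart, zero_sub]
    rw [CFC.posPart_sub_negPart y hy] at e'
    rw [hs, e', neg_mul]
  have h1 := h y⁻
  rw [e, map_neg] at h1
  have h2 : 0 ≤ τ (y⁻ * y⁻ * y⁻) := by simpa using OrderHomClass.mono τ h3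
  have h0 := hτ _ h3 (le_antisymm (neg_nonneg.1 h1) h2)
  have hsq : star (y⁻ * y⁻) * (y⁻ * y⁻) = 0 := by
    rw [star_mul, hs, ← mul_assoc, h0, zero_mul]
  have hsq' := CStarRing.star_mul_self_eq_zero_iff _ |>.1 hsq
  refine CStarRing.star_mul_self_eq_zero_iff _ |>.1 ?_
  rw [hs, hsq']

theorem PositiveLinearMap.IsFaithful.nonneg_of_forall {τ : C →ₚ[ℂ] ℂ} (hτ : τ.IsFaithful)
    {y : C} (h : ∀ d, 0 ≤ τ (star d * y * d)) : 0 ≤ y := by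
  refine hτ.nonneg_of_isSelfAdjoint ?_ h
  -- All `τ (d⋆ * y * d)` are real, so `z` tests to zero; hence both `z` and `-z` are positive.
  set z : C := Complex.I • (y - star y) with hz
  have hzs : IsSelfAdjoint z := by
    rw [IsSelfAdjoint, hz, star_smul, star_sub, star_star]
    simp [← smul_neg]
  have h0 (d : C) : τ (star d * z * d) = 0 := by
    have e : star d * star y * d = star (star d * y * d) := by simp [mul_assoc]
    have e' : star d * z * d = Complex.I • (star d * y * d - star (star d * y * d)) := by
      rw [← e, hz, mul_smul_comm, smul_mul_assoc, mul_sub, sub_mul]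
    rw [e', map_smul, map_sub, map_star, (IsSelfAdjoint.of_nonneg (h d)).star_eq, sub_self,
      smul_zero]
  have hz0 : z = 0 := by
    refine le_antisymm (neg_nonneg.1 ?_) ?_
    · refine hτ.nonneg_of_isSelfAdjoint hzs.neg fun d => ?_
      simp [h0]
    · exact hτ.nonneg_of_isSelfAdjoint hzs fun d => (h0 d).ge
  rw [hz, smul_eq_zero, sub_eq_zero] at hz0
  exact (hz0.resolve_left Complex.I_ne_zero).symm

end Positivity

/-! ### Support projections and the Riesz extension -/

section Extension

theorem exists_support_projection {A : Type*} [CStarAlgebra A] [PartialOrder A]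
    [StarOrderedRing A] [FiniteDimensional ℂ A] {e : A} (he : 0 ≤ e) :
    ∃ P : A, IsSelfAdjoint P ∧ P * P = P ∧ (∃ ε : ℝ, 0 < ε ∧ ε • P ≤ e) ∧
      ∀ x, 0 ≤ x → x ≤ e → P * x * P = x := by
  have hfin := finite_real_spectrum_of_finiteDimensional e
  have hcont (f : ℝ → ℝ) : ContinuousOn f (spectrum ℝ e) := hfin.continuousOn f
  have hsa : IsSelfAdjoint e := .of_nonneg he
  let f : ℝ → ℝ := fun t => if t = 0 then 0 else 1
  refine ⟨cfc f e, cfc_predicate f e, ?_, ?_, ?_⟩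
  · rw [← cfc_mul f f e (hcont _) (hcont _)]
    congr 1
    ext t
    by_cases h : t = 0 <;> simp [f, h]
  · obtain ⟨ε, hε, hle⟩ : ∃ ε : ℝ, 0 < ε ∧ ∀ t ∈ spectrum ℝ e, ε * f t ≤ t := by
      let s := (hfin.toFinset.filter (0 < ·))
      -- Inserting `1` keeps the set nonempty when `e` has no positive spectrum.
      refine ⟨(insert 1 s).min' (by simp), ?_, fun t ht => ?_⟩
      · refine (Finset.lt_min'_iff _ _).2 fun t ht => ?_
        rcases Finset.mem_insert.1 ht with rfl | ht
        · exact one_pos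
        · exact (Finset.mem_filter.1 ht).2
      · rcases (spectrum_nonneg_of_nonneg he ht).eq_or_lt with rfl | h
        · simp [f]
        · simp only [f, h.ne', if_false, mul_one]
          exact Finset.min'_le _ _ (Finset.mem_insert_of_mem (by simp [s, ht, h]))
    refine ⟨ε, hε, ?_⟩
    rw [← cfc_smul ε f e (hcont _)]
    conv_rhs => rw [← cfc_id ℝ e hsa]
    exact cfc_mono (by simpa using hle) (hcont _) (hcont _)
  · intro x hx hxe
    set Q : A := cfc (fun t : ℝ => 1 - f t) e with hQ
    have hQP : cfc f e = 1 - Q := by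
      rw [hQ, cfc_sub (fun _ => (1 : ℝ)) f e (hcont _) (hcont _), cfc_const_one ℝ e]
      abel
    have hQs : star Q = Q := (cfc_predicate (fun t : ℝ => 1 - f t) e : IsSelfAdjoint Q).star_eq
    have hQe : e * Q = 0 := by
      conv_lhs => rw [hQ, ← cfc_id ℝ e hsa]
      rw [cfc_id ℝ e hsa]
      conv_lhs => enter [1]; rw [← cfc_id ℝ e hsa]
      rw [← cfc_mul _ _ e (hcont _) (hcont _), ← cfc_zero ℝ e]
      congr 1
      ext t
      by_cases h : t = 0 <;> simp [f, h]
    -- Compressing `x ≤ e` by `Q` gives `Q * x * Q ≤ 0`, as `e * Q = 0`.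
    have hxQ : x * Q = 0 := by
      obtain ⟨y, rfl⟩ := CStarAlgebra.nonneg_iff_eq_star_mul_self.1 hx
      have h1 : star Q * (star y * y) * Q ≤ 0 := by
        have := star_left_conjugate_le_conjugate hxe Q
        rwa [mul_assoc (star Q) e, hQe, mul_zero] at this
      have h2 : star (y * Q) * (y * Q) = 0 := by
        refine le_antisymm ?_ (star_mul_self_nonneg _)
        simpa [mul_assoc] using h1
      rw [mul_assoc, CStarRing.star_mul_self_eq_zero_iff _ |>.1 h2, mul_zero]
    have hQx : Q * x = 0 := by
      have := congrArg star hxQ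
      rwa [star_mul, hQs, (IsSelfAdjoint.of_nonneg hx).star_eq, star_zero] at this
    rw [hQP, sub_mul, one_mul, hQx, sub_zero, mul_sub, hxQ, mul_one, sub_zero]

variable {C : Type*} [CStarAlgebra C] [PartialOrder C] [StarOrderedRing C]

/-- The elements whose real part is positive after compression by `P`. -/
def compressionCone (P : C) : PointedCone ℝ C where
  carrier := {x | 0 ≤ P * (x + star x) * P}
  add_mem' {x y} hx hy := by
    have : P * (x + y + star (x + y)) * P = P * (x + star x) * P + P * (y + star y) * P := by
      rw [star_add]; noncomm_ring
    simpa only [Set.mem_ofPred_eq, this] using add_nonneg hx hy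
  zero_mem' := by simp
  smul_mem' c x hx := by
    have : P * ((c : ℝ) • x + star ((c : ℝ) • x)) * P = (c : ℝ) • (P * (x + star x) * P) := by
      rw [star_smul, star_trivial, ← smul_add, mul_smul_comm, smul_mul_assoc]
    change 0 ≤ P * ((c : ℝ) • x + star ((c : ℝ) • x)) * P
    rw [this]
    exact smul_nonneg c.2 hx

/-- A positive functional on a self-adjoint subspace `W` of a C⋆-algebra extends to a positive
functional as soon as `W` contains an element that is bounded below by a multiple of a
projection `P` under which `W` is compressed to itself. -/
theorem exists_positive_extension (W : Submodule ℂ C) (hW : ∀ x ∈ W, star x ∈ W)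
    (g : W →ₗ[ℂ] ℂ) (hstar : ∀ x : W, g ⟨star x, hW x x.2⟩ = star (g x))
    (hpos : ∀ x : W, 0 ≤ (x : C) → 0 ≤ g x) {P e : C} (hP : IsSelfAdjoint P) (hPP : P * P = P)
    {ε : ℝ} (hε : 0 < ε) (hle : ε • P ≤ e) (he : e ∈ W) (hWP : ∀ x ∈ W, P * x * P = x) :
    ∃ G : C →ₗ[ℂ] ℂ, (∀ x : W, G x = g x) ∧ ∀ x, 0 ≤ x → 0 ≤ G x := by
  have hP0 : 0 ≤ P := by
    have := star_mul_self_nonneg P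
    rwa [hP.star_eq, hPP] at this
  have he0 : 0 ≤ e := (smul_nonneg hε.le hP0).trans hle
  let f : C →ₗ.[ℝ] ℝ :=
    { domain := W.restrictScalars ℝ
      toFun := Complex.reLm ∘ₗ g.restrictScalars ℝ }
  -- Compression by `P` lets `e` act as an order unit on all of `C`. On `W` it changes nothing.
  obtain ⟨F, hF, hF0⟩ := riesz_extension (compressionCone P) f (by
    rintro ⟨x, hx⟩ hxs
    have hx' : x ∈ W := hx
    have h1 : 0 ≤ x + star x := by
      have : 0 ≤ P * (x + star x) * P := hxs
      rwa [hWP _ (W.add_mem hx' (hW x hx'))] at this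
    have h2 := hpos (⟨x, hx'⟩ + ⟨star x, hW x hx'⟩) h1
    rw [map_add, hstar ⟨x, hx'⟩] at h2
    have h3 := (Complex.le_def.1 h2).1
    simp only [Complex.zero_re, Complex.add_re, Complex.star_def, Complex.conj_re] at h3
    change 0 ≤ (g ⟨x, hx'⟩).re
    linarith) (by
    intro y
    set h := y + star y with hh
    have hhs : IsSelfAdjoint h := IsSelfAdjoint.add_star_self y
    -- Chosen so that `2 * c * ε = ‖h‖`, whence `(2 * c) • e ≥ ‖h‖ • P ≥ -(P * h * P)`.
    set c : ℝ := ‖h‖ / (2 * ε) with hc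
    have hc0 : 0 ≤ c := by positivity
    have hcW : c • e ∈ W.restrictScalars ℝ := Submodule.smul_mem _ _ he
    refine ⟨⟨c • e, hcW⟩, ?_⟩
    change 0 ≤ P * (c • e + y + star (c • e + y)) * P
    have e1 : P * (c • e + y + star (c • e + y)) * P = (2 * c) • e + P * h * P := by
      have : c • e + y + star (c • e + y) = (2 * c) • e + h := by
        rw [star_add, star_smul, (IsSelfAdjoint.of_nonneg he0).star_eq, star_trivial, mul_smul,
          two_smul, hh]
        abel
      rw [this, mul_add, add_mul, mul_smul_comm, smul_mul_assoc, hWP e he]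
    have e2 : -(P * h * P) ≤ ‖h‖ • P := by
      have := CStarAlgebra.star_left_conjugate_le_norm_smul (a := P) (b := -h) hhs.neg
      rwa [norm_neg, hP.star_eq, hPP, mul_neg, neg_mul] at this
    have e3 : ‖h‖ • P ≤ (2 * c) • e := by
      have := smul_le_smul_of_nonneg_left hle (by positivity : 0 ≤ 2 * c)
      rwa [smul_smul, show 2 * c * ε = ‖h‖ by rw [hc]; field_simp] at this
    rw [e1, ← sub_neg_eq_add, sub_nonneg]
    exact e2.trans e3)
  have hre (x : C) : ((Module.Dual.extendRCLike F : Module.Dual ℂ C) x).re = F x := by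
    simp [Module.Dual.extendRCLike_apply]
  have him (x : C) : ((Module.Dual.extendRCLike F : Module.Dual ℂ C) x).im
      = -F (Complex.I • x) := by
    simp [Module.Dual.extendRCLike_apply]
  have hFW (x : W) : F x = (g x).re := hF ⟨x, x.2⟩
  refine ⟨Module.Dual.extendRCLike F, fun x => Complex.ext ?_ ?_, fun x hx => ?_⟩
  · rw [hre, hFW]
  · rw [him, ← Submodule.coe_smul, hFW, map_smul]
    simp
  · have hxs := (IsSelfAdjoint.of_nonneg hx).star_eq
    rw [Complex.le_def, hre, him]
    refine ⟨hF0 x ?_, ?_⟩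
    · change 0 ≤ P * (x + star x) * P
      have := star_left_conjugate_nonneg (add_nonneg hx (hxs.symm ▸ hx : 0 ≤ star x)) P
      rwa [hP.star_eq] at this
    -- Skew-adjoint elements lie in the cone with both signs, so `F` kills them and the imaginary
    -- part vanishes.
    · have key (c : ℂ) (hc : star c = -c) : 0 ≤ F (c • x) := by
        refine hF0 _ ?_
        change 0 ≤ P * (c • x + star (c • x)) * P
        rw [star_smul, hxs, hc, neg_smul, add_neg_cancel]
        simp
      have h1 := key Complex.I (by simp)
      have h2 := key (-Complex.I) (by simp)
      rw [neg_smul, map_neg] at h2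
      rw [Complex.zero_im]
      linarith

end Extension

theorem CStarAlgebra.exists_eq_star_mul_self {C : Type*} [CStarAlgebra C] [PartialOrder C]
    [StarOrderedRing C] {a : C} (ha : 0 ≤ a) : ∃ b, a = star b * b :=
  CStarAlgebra.nonneg_iff_eq_star_mul_self.1 ha

/-! ### Positive matrices over a C⋆-algebra -/

namespace CStarMatrix

variable {A : Type*} [CStarAlgebra A] {n k : ℕ}

theorem star_mul_self_apply (Y : CStarMatrix (Fin n) (Fin n) A) (i j : Fin n) :
    (star Y * Y) i j = ∑ r, star (Y r i) * Y r j := by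
  simp [mul_apply, star_apply]

/-- The diagonal matrix with constant diagonal entry `a`. -/
def constDiagonal (n : ℕ) (a : A) : CStarMatrix (Fin n) (Fin n) A :=
  ofMatrix (Matrix.diagonal fun _ => a)

theorem constDiagonal_apply (a : A) (i j : Fin n) :
    constDiagonal n a i j = if i = j then a else 0 := by
  simp [constDiagonal, Matrix.diagonal_apply]

theorem constDiagonal_mul_apply (a : A) (X : CStarMatrix (Fin n) (Fin n) A) (i j : Fin n) :
    (constDiagonal n a * X) i j = a * X i j := by
  simp [mul_apply, constDiagonal_apply]

theorem mul_constDiagonal_apply (a : A) (X : CStarMatrix (Fin n) (Fin n) A) (i j : Fin n) :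
    (X * constDiagonal n a) i j = X i j * a := by
  simp [mul_apply, constDiagonal_apply]

theorem star_constDiagonal (a : A) : star (constDiagonal n a) = constDiagonal n (star a) := by
  ext i j
  simp only [star_apply, constDiagonal_apply, eq_comm (a := j)]
  split <;> simp

theorem constDiagonal_mul (a b : A) :
    constDiagonal n (a * b) = constDiagonal n a * constDiagonal n b := by
  ext i j
  rw [constDiagonal_mul_apply, constDiagonal_apply, constDiagonal_apply, mul_ite, mul_zero]

variable [PartialOrder A] [StarOrderedRing A]

theorem exists_eq_sum_star_mul {M : CStarMatrix (Fin n) (Fin n) A} (hM : 0 ≤ M) :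
    ∃ Y : Fin n → Fin n → A, ∀ i j, M i j = ∑ r, star (Y r i) * Y r j := by
  obtain ⟨Y, rfl⟩ := CStarAlgebra.exists_eq_star_mul_self hM
  exact ⟨fun i j => Y i j, star_mul_self_apply Y⟩

theorem rankOne_nonneg (z : Fin n → A) :
    0 ≤ (ofMatrix (.of fun i j => star (z i) * z j) : CStarMatrix (Fin n) (Fin n) A) := by
  rcases isEmpty_or_nonempty (Fin n) with h | ⟨⟨i₀⟩⟩
  · exact le_of_eq (ext fun i => h.elim i)
  · let R : CStarMatrix (Fin n) (Fin n) A := ofMatrix (.of fun i j => if i = i₀ then z j else 0)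
    convert star_mul_self_nonneg R
    ext i j
    rw [star_mul_self_apply, Finset.sum_eq_single i₀ (by simp +contextual [R]) (by simp)]
    simp [R]

/-- This is `V⋆ M V` for a rectangular scalar `V`; writing `M = Y⋆ Y`, each row of `Y V` contributes
a rank-one term. -/
theorem compress_nonneg {M : CStarMatrix (Fin k) (Fin k) A} (hM : 0 ≤ M) (v : Fin k → Fin n → ℂ) :
    0 ≤ (ofMatrix (.of fun i j => ∑ p, ∑ q, (star (v p i) * v q j) • M p q) :
      CStarMatrix (Fin n) (Fin n) A) := by
  obtain ⟨Y, hY⟩ := exists_eq_sum_star_mul hM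
  convert Finset.sum_nonneg fun s (_ : s ∈ Finset.univ) =>
    rankOne_nonneg (fun j => ∑ q, v q j • Y s q)
  ext i j
  have h (s : Finset (Fin k)) (f : Fin k → CStarMatrix (Fin n) (Fin n) A) :
      (∑ t ∈ s, f t) i j = ∑ t ∈ s, f t i j := by
    classical
    induction s using Finset.induction_on with
    | empty => simp
    | insert a s ha ih => simp [Finset.sum_insert ha, ih]
  rw [h]
  simp only [ofMatrix_apply, Matrix.of_apply, star_sum, star_smul, Finset.sum_mul_sum, hY,
    Finset.smul_sum, smul_mul_smul_comm]
  symm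
  rw [Finset.sum_comm]
  refine Finset.sum_congr rfl fun p _ => ?_
  rw [Finset.sum_comm]

theorem sum_functional_nonneg (τ : A →ₚ[ℂ] ℂ) {M : CStarMatrix (Fin k) (Fin k) A} (hM : 0 ≤ M)
    (d : Fin k → A) : 0 ≤ ∑ p, ∑ q, τ (star (d p) * M p q * d q) := by
  obtain ⟨Y, hY⟩ := exists_eq_sum_star_mul hM
  have : ∑ p, ∑ q, τ (star (d p) * M p q * d q) =
      τ (∑ r, star (∑ q, Y r q * d q) * ∑ q, Y r q * d q) := by
    simp only [star_sum, Finset.sum_mul_sum, map_sum]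
    symm
    rw [Finset.sum_comm]
    refine Finset.sum_congr rfl fun p _ => ?_
    rw [Finset.sum_comm]
    simp only [hY, Finset.sum_mul, Finset.mul_sum, star_mul, mul_assoc, map_sum]
  rw [this]
  simpa using OrderHomClass.mono τ
    (Finset.sum_nonneg fun r (_ : r ∈ Finset.univ) => star_mul_self_nonneg (∑ q, Y r q * d q))

/-- The sum of the values of a positive functional at the diagonal entries of a matrix. -/
noncomputable def traceFunctional (k : ℕ) (τ : A →ₚ[ℂ] ℂ) :
    CStarMatrix (Fin k) (Fin k) A →ₚ[ℂ] ℂ :=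
  .mk₀
    { toFun := fun X => ∑ p, τ (X p p)
      map_add' := fun X Y => by simp [Finset.sum_add_distrib]
      map_smul' := fun c X => by simp [Finset.mul_sum] }
    (fun X hX => by
      obtain ⟨Y, hY⟩ := exists_eq_sum_star_mul hX
      change 0 ≤ ∑ p, τ (X p p)
      refine Finset.sum_nonneg fun p _ => ?_
      rw [hY, map_sum]
      exact Finset.sum_nonneg fun r _ => by
        simpa using OrderHomClass.mono τ (star_mul_self_nonneg (Y r p)))

theorem traceFunctional_apply (τ : A →ₚ[ℂ] ℂ) (X : CStarMatrix (Fin k) (Fin k) A) :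
    traceFunctional k τ X = ∑ p, τ (X p p) := rfl

theorem isFaithful_traceFunctional {τ : A →ₚ[ℂ] ℂ} (hτ : τ.IsFaithful) :
    (traceFunctional k τ).IsFaithful := by
  intro X hX h
  obtain ⟨Y, rfl⟩ := CStarAlgebra.exists_eq_star_mul_self hX
  have hp (r p : Fin k) : 0 ≤ star (Y r p) * Y r p := star_mul_self_nonneg _
  have hτp (r p : Fin k) : 0 ≤ τ (star (Y r p) * Y r p) := by
    simpa using OrderHomClass.mono τ (hp r p)
  simp only [traceFunctional_apply, star_mul_self_apply, map_sum] at h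
  have hY : Y = 0 := by
    ext r p
    have h1 := (Finset.sum_eq_zero_iff_of_nonneg fun p _ =>
      Finset.sum_nonneg fun r _ => hτp r p).1 h p (Finset.mem_univ _)
    have h2 := (Finset.sum_eq_zero_iff_of_nonneg fun r _ => hτp r p).1 h1 r (Finset.mem_univ _)
    exact CStarRing.star_mul_self_eq_zero_iff _ |>.1 (hτ _ (hp r p) h2)
  rw [hY, mul_zero]

/-- Under `traceFunctional`, a test matrix `D` splits into its columns, each one a tuple `d`. -/
theorem nonneg_of_forall_sum_functional_nonneg {τ : A →ₚ[ℂ] ℂ} (hτ : τ.IsFaithful)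
    {M : CStarMatrix (Fin k) (Fin k) A}
    (h : ∀ d : Fin k → A, 0 ≤ ∑ p, ∑ q, τ (star (d p) * M p q * d q)) : 0 ≤ M := by
  refine (isFaithful_traceFunctional hτ).nonneg_of_forall fun D => ?_
  rw [traceFunctional_apply]
  refine Finset.sum_nonneg fun r _ => ?_
  have e : τ ((star D * M * D) r r) = ∑ p, ∑ q, τ (star (D p r) * M p q * D q r) := by
    simp only [mul_apply, star_apply, Finset.sum_mul, map_sum]
    exact Finset.sum_comm
  rw [e]
  exact h fun p => D p r

theorem constDiagonal_nonneg {a : A} (ha : 0 ≤ a) : 0 ≤ constDiagonal n a := by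
  obtain ⟨y, rfl⟩ := CStarAlgebra.exists_eq_star_mul_self ha
  rw [constDiagonal_mul, ← star_constDiagonal]
  exact star_mul_self_nonneg _

theorem smul_constDiagonal_le {a b : A} {ε : ℝ} (h : ε • a ≤ b) :
    ε • constDiagonal n a ≤ constDiagonal n b := by
  rw [← sub_nonneg]
  convert constDiagonal_nonneg (n := n) (sub_nonneg.2 h)
  ext i j
  simp only [sub_apply, smul_apply, constDiagonal_apply]
  split <;> simp

end CStarMatrix

/-! ### An orthonormal basis for the trace -/

section TraceBasis

variable (B : Type*) [CStarAlgebra B] [PartialOrder B] [StarOrderedRing B] [FiniteDimensional ℂ B]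

theorem isFaithful_lmulTracePos : (lmulTracePos B).IsFaithful :=
  fun _ hx h => eq_zero_of_lmulTrace_eq_zero hx h

theorem lmulTracePos_mul_comm (x y : B) : lmulTracePos B (x * y) = lmulTracePos B (y * x) :=
  lmulTrace_mul_comm x y

/-- The inner product `τ (x⋆ * y)` defined by the trace of left multiplication. -/
noncomputable abbrev lmulTraceCore : InnerProductSpace.Core ℂ B where
  inner x y := lmulTracePos B (star x * y)
  conj_inner_symm x y := by
    rw [← Complex.star_def, ← map_star, star_mul, star_star]
  re_inner_nonneg x := by
    have h : 0 ≤ lmulTracePos B (star x * x) := by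
      simpa using OrderHomClass.mono (lmulTracePos B) (star_mul_self_nonneg x)
    exact (Complex.le_def.1 h).1
  add_left x y z := by rw [star_add, add_mul, map_add]
  smul_left x y r := by rw [star_smul, smul_mul_assoc, map_smul, smul_eq_mul, Complex.star_def]
  definite x h := CStarRing.star_mul_self_eq_zero_iff _ |>.1
    (isFaithful_lmulTracePos B _ (star_mul_self_nonneg x) h)

/-- A finite-dimensional C⋆-algebra has a faithful trace that is computed by an orthonormal
basis for its own inner product. -/
theorem exists_faithful_trace_basis :
    ∃ (τ : B →ₚ[ℂ] ℂ) (n : ℕ) (b : Fin n → B), τ.IsFaithful ∧ (∀ x y, τ (x * y) = τ (y * x)) ∧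
      (∀ x, ∑ i, τ (star (b i) * x) • b i = x) ∧ ∀ x, τ x = ∑ i, τ (star (b i) * x * b i) := by
  obtain ⟨n, b, hb, hT⟩ := exists_orthonormal_of_core (lmulTraceCore B)
  refine ⟨lmulTracePos B, n, b, isFaithful_lmulTracePos B, lmulTracePos_mul_comm B, hb, fun x => ?_⟩
  refine (hT (Algebra.lmul ℂ B x)).trans (Finset.sum_congr rfl fun i _ => ?_)
  rw [mul_assoc]
  rfl

end TraceBasis

/-! ### Maps into `B` and functionals on matrices -/

section MapOfFunctional

variable {A B : Type*} [CStarAlgebra A] [CStarAlgebra B] [PartialOrder B]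

/-- The matrix with a single entry, as a linear function of the entry. -/
noncomputable def CStarMatrix.singleₗ {n : ℕ} (i j : Fin n) : A →ₗ[ℂ] CStarMatrix (Fin n) (Fin n) A :=
  CStarMatrix.ofMatrixₗ.toLinearMap ∘ₗ Matrix.singleLinearMap ℂ i j

theorem CStarMatrix.singleₗ_apply {n : ℕ} (i j k l : Fin n) (a : A) :
    CStarMatrix.singleₗ i j a k l = if i = k ∧ j = l then a else 0 := rfl

theorem CStarMatrix.sum_singleₗ {n : ℕ} (X : CStarMatrix (Fin n) (Fin n) A) :
    ∑ i, ∑ j, CStarMatrix.singleₗ i j (X i j) = X :=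
  (Matrix.matrix_eq_sum_single (X : Matrix (Fin n) (Fin n) A)).symm

/-- The linear map `Φ` with `τ (Φ a * c) = ∑ i, ∑ j, G (E i j a) * τ (b j ⋆ * c * b i)`. -/
noncomputable def mapOfFunctional {n : ℕ} (τ : B →ₚ[ℂ] ℂ) (b : Fin n → B)
    (G : CStarMatrix (Fin n) (Fin n) A →ₗ[ℂ] ℂ) : A →ₗ[ℂ] B :=
  ∑ k, (∑ i, ∑ j, τ (star (b j) * b k * b i) • (G ∘ₗ CStarMatrix.singleₗ i j)).smulRight
    (star (b k))

variable {n : ℕ} {τ : B →ₚ[ℂ] ℂ} {b : Fin n → B} (G : CStarMatrix (Fin n) (Fin n) A →ₗ[ℂ] ℂ)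

theorem apply_mapOfFunctional_mul (hb : ∀ x, ∑ i, τ (star (b i) * x) • b i = x) (a : A) (c : B) :
    τ (mapOfFunctional τ b G a * c) =
      ∑ i, ∑ j, G (CStarMatrix.singleₗ i j a) * τ (star (b j) * c * b i) := by
  conv_rhs => rw [← hb c]
  simp only [mapOfFunctional, LinearMap.sum_apply, LinearMap.smulRight_apply, LinearMap.smul_apply,
    LinearMap.comp_apply, Finset.sum_mul, Finset.mul_sum, map_sum, smul_mul_assoc, map_smul,
    mul_smul_comm, smul_eq_mul]
  rw [Finset.sum_comm]
  refine Finset.sum_congr rfl fun i _ => ?_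
  rw [Finset.sum_comm]
  refine Finset.sum_congr rfl fun j _ => Finset.sum_congr rfl fun k _ => ?_
  ring

/-- Parseval's identity for `b`. -/
theorem inner_eq_sum (hb : ∀ x, ∑ i, τ (star (b i) * x) • b i = x) (x y : B) :
    τ (x * y) = ∑ i, τ (x * b i) * τ (star (b i) * y) := by
  conv_lhs => rw [← hb y]
  simp [Finset.mul_sum, mul_comm]

/-- The matrices with entries in a subspace. -/
def Submodule.cstarMatrix (n : ℕ) (J : Submodule ℂ A) :
    Submodule ℂ (CStarMatrix (Fin n) (Fin n) A) where
  carrier := {X | ∀ i j, X i j ∈ J}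
  add_mem' hX hY i j := J.add_mem (hX i j) (hY i j)
  zero_mem' _ _ := J.zero_mem
  smul_mem' c _ hX i j := J.smul_mem c (hX i j)

/-- The functional on matrices over `J` which a linear map on `J`, a functional `τ` and a tuple
`b` define. -/
noncomputable def LinearMap.matrixFunctional {n : ℕ} {J : Submodule ℂ A} (Ξ : J →ₗ[ℂ] B) (τ : B →ₚ[ℂ] ℂ)
    (b : Fin n → B) : J.cstarMatrix n →ₗ[ℂ] ℂ where
  toFun X := ∑ i, ∑ j, τ (star (b i) * Ξ ⟨X.1 i j, X.2 i j⟩ * b j)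
  map_add' X Y := by
    simp only [← Finset.sum_add_distrib]
    refine Finset.sum_congr rfl fun i _ => Finset.sum_congr rfl fun j _ => ?_
    rw [← map_add, ← add_mul, ← mul_add, ← map_add]
    rfl
  map_smul' c X := by
    simp only [RingHom.id_apply, smul_eq_mul, Finset.mul_sum]
    refine Finset.sum_congr rfl fun i _ => Finset.sum_congr rfl fun j _ => ?_
    have h : τ (star (b i) * (c • Ξ ⟨X.1 i j, X.2 i j⟩) * b j) =
        c * τ (star (b i) * Ξ ⟨X.1 i j, X.2 i j⟩ * b j) := by
      rw [mul_smul_comm, smul_mul_assoc, map_smul, smul_eq_mul]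
    rw [← h, ← map_smul]
    rfl

theorem mapOfFunctional_eq_of_extends [StarOrderedRing B] {J : Submodule ℂ A} (hτ : τ.IsFaithful)
    (hb : ∀ x, ∑ i, τ (star (b i) * x) • b i = x) (htr : ∀ x, τ x = ∑ i, τ (star (b i) * x * b i))
    {Ξ : J →ₗ[ℂ] B} (hG : ∀ X : J.cstarMatrix n, G X = Ξ.matrixFunctional τ b X) (x : J) :
    mapOfFunctional τ b G x = Ξ x := by
  have hs (i j : Fin n) : G (CStarMatrix.singleₗ i j (x : A)) = τ (star (b i) * Ξ x * b j) := by
    have hmem : CStarMatrix.singleₗ i j (x : A) ∈ J.cstarMatrix n := fun k l => by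
      rw [CStarMatrix.singleₗ_apply]
      split
      exacts [x.2, J.zero_mem]
    refine (hG ⟨_, hmem⟩).trans ?_
    change ∑ k, ∑ l, τ (star (b k) * Ξ ⟨CStarMatrix.singleₗ i j (x : A) k l, _⟩ * b l) = _
    have e (k l : Fin n) : (⟨CStarMatrix.singleₗ i j (x : A) k l, hmem k l⟩ : J) =
        if i = k ∧ j = l then x else 0 := by
      refine Subtype.ext ((CStarMatrix.singleₗ_apply i j k l (x : A)).trans ?_)
      split <;> rfl
    simp only [e]
    rw [Finset.sum_eq_single i (by simp +contextual [eq_comm]) (by simp),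
      Finset.sum_eq_single j (by simp +contextual [eq_comm]) (by simp)]
    simp
  -- Parseval collapses the sum over `j`; `htr` then collapses the sum over `i`.
  have key (c : B) : τ (mapOfFunctional τ b G x * c) = τ (Ξ x * c) := by
    rw [apply_mapOfFunctional_mul G hb, htr (Ξ x * c)]
    refine Finset.sum_congr rfl fun i _ => ?_
    simp only [hs, ← mul_assoc]
    rw [mul_assoc _ c, inner_eq_sum hb]
    simp only [mul_assoc]
  rw [← sub_eq_zero]
  set y := mapOfFunctional τ b G x - Ξ x with hy
  refine CStarRing.mul_star_self_eq_zero_iff _ |>.1 (hτ _ (mul_star_self_nonneg y) ?_)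
  conv_lhs => rw [hy, sub_mul, map_sub, key, sub_self]

end MapOfFunctional

/-! ### Extending the functional and recovering a cp map -/

variable {A B : Type*} [CStarAlgebra A] [PartialOrder A] [StarOrderedRing A]
  [CStarAlgebra B] [PartialOrder B] [StarOrderedRing B] {J : Submodule ℂ A}

theorem LinearMap.IsCompletelyPositiveOn.apply_nonneg {Ξ : J →ₗ[ℂ] B}
    (hΞ : Ξ.IsCompletelyPositiveOn) (x : J) (hx : 0 ≤ (x : A)) : 0 ≤ Ξ x := by
  have h := hΞ 1 (CStarMatrix.ofMatrix (.of fun _ _ => x)) (by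
    convert CStarMatrix.constDiagonal_nonneg (n := 1) hx
    ext i j
    simp [CStarMatrix.constDiagonal_apply, Subsingleton.elim i j])
  obtain ⟨Y, hY⟩ := CStarMatrix.exists_eq_sum_star_mul h
  have h0 := hY 0 0
  simp only [CStarMatrix.map_apply, CStarMatrix.ofMatrix_apply, Matrix.of_apply] at h0
  rw [h0]
  exact Finset.sum_nonneg fun r _ => star_mul_self_nonneg _

/-- Both sides are conjugate-linear and agree on the positive generators. -/
theorem LinearMap.map_star_of_nonneg {Ξ : J →ₗ[ℂ] B} (hJ : J.IsSelfAdjointSubspace)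
    (hJ_pos : J.IsPositivelyGenerated) (hΞ : ∀ x : J, 0 ≤ (x : A) → 0 ≤ Ξ x) (x : J) :
    Ξ ⟨star (x : A), hJ x x.2⟩ = star (Ξ x) := by
  obtain ⟨x, hx⟩ := x
  have hx' := hx
  rw [← hJ_pos] at hx'
  induction hx' using Submodule.span_induction with
  | mem a ha =>
    have e : (⟨star a, hJ a hx⟩ : J) = ⟨a, hx⟩ :=
      Subtype.ext (IsSelfAdjoint.of_nonneg ha.2).star_eq
    rw [e, (IsSelfAdjoint.of_nonneg (hΞ ⟨a, hx⟩ ha.2)).star_eq]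
  | zero =>
    have e : (⟨star 0, hJ 0 hx⟩ : J) = 0 := Subtype.ext (star_zero A)
    have e' : (⟨0, hx⟩ : J) = 0 := rfl
    rw [e, e', map_zero, star_zero]
  | add a c ha hc iha ihc =>
    rw [hJ_pos] at ha hc
    have e : (⟨star (a + c), hJ _ hx⟩ : J) = ⟨star a, hJ a ha⟩ + ⟨star c, hJ c hc⟩ :=
      Subtype.ext (star_add a c)
    have e' : (⟨a + c, hx⟩ : J) = ⟨a, ha⟩ + ⟨c, hc⟩ := rfl
    rw [e, e', map_add, map_add, star_add, iha ha, ihc hc]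
  | smul r a ha iha =>
    rw [hJ_pos] at ha
    have e : (⟨star (r • a), hJ _ hx⟩ : J) = star r • ⟨star a, hJ a ha⟩ :=
      Subtype.ext (star_smul r a)
    have e' : (⟨r • a, hx⟩ : J) = r • ⟨a, ha⟩ := rfl
    rw [e, e', map_smul, map_smul, star_smul, iha ha]

/-- Finitely many positive elements span `J`, and each is at most their sum `e`, so the support
projection of `e` fixes them all. -/
theorem Submodule.IsPositivelyGenerated.exists_support_projection [FiniteDimensional ℂ A]
    (hJ : J.IsPositivelyGenerated) :
    ∃ P e : A, IsSelfAdjoint P ∧ P * P = P ∧ (∃ ε : ℝ, 0 < ε ∧ ε • P ≤ e) ∧ e ∈ J ∧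
      ∀ x ∈ J, P * x * P = x := by
  obtain ⟨s, hs, hspan⟩ := (Submodule.fg_span_iff_fg_span_finset_subset _).1
    (IsNoetherian.noetherian (Submodule.span ℂ {a : A | a ∈ J ∧ 0 ≤ a}))
  rw [hJ] at hspan
  have he : 0 ≤ ∑ a ∈ s, a := Finset.sum_nonneg fun a ha => (hs ha).2
  obtain ⟨P, hP, hPP, hε, h⟩ := _root_.exists_support_projection he
  refine ⟨P, ∑ a ∈ s, a, hP, hPP, hε, J.sum_mem fun a ha => (hs ha).1, fun x hx => ?_⟩
  rw [hspan] at hx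
  induction hx using Submodule.span_induction with
  | mem a ha => exact h a (hs ha).2 (Finset.single_le_sum (fun c hc => (hs hc).2) ha)
  | zero => simp
  | add a c _ _ iha ihc => rw [mul_add, add_mul, iha, ihc]
  | smul r a _ iha => rw [mul_smul_comm, smul_mul_assoc, iha]

theorem LinearMap.exists_positive_extension_matrixFunctional [FiniteDimensional ℂ A]
    (hJ_sa : J.IsSelfAdjointSubspace) (hJ_pos : J.IsPositivelyGenerated)
    {Ξ : J →ₗ[ℂ] B} (hΞ : Ξ.IsCompletelyPositiveOn) (τ : B →ₚ[ℂ] ℂ) {n : ℕ} (b : Fin n → B) :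
    ∃ G : CStarMatrix (Fin n) (Fin n) A →ₗ[ℂ] ℂ,
      (∀ X : J.cstarMatrix n, G X = Ξ.matrixFunctional τ b X) ∧ ∀ X, 0 ≤ X → 0 ≤ G X := by
  obtain ⟨P, e, hP, hPP, ⟨ε, hε, hle⟩, he, hPJ⟩ := hJ_pos.exists_support_projection
  refine exists_positive_extension (J.cstarMatrix n)
    (fun X hX i j => hJ_sa _ (hX j i)) (Ξ.matrixFunctional τ b) (fun X => ?_) (fun X hX => ?_)
    (P := CStarMatrix.constDiagonal n P) (e := CStarMatrix.constDiagonal n e)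
    ?_ ?_ hε (CStarMatrix.smul_constDiagonal_le hle) (fun i j => ?_) (fun X hX => ?_)
  · change ∑ i, ∑ j, τ (star (b i) * Ξ ⟨star (X.1 j i), _⟩ * b j) =
      star (∑ i, ∑ j, τ (star (b i) * Ξ ⟨X.1 i j, _⟩ * b j))
    rw [Finset.sum_comm]
    simp only [star_sum]
    refine Finset.sum_congr rfl fun i _ => Finset.sum_congr rfl fun j _ => ?_
    rw [← map_star, LinearMap.map_star_of_nonneg hJ_sa hJ_pos hΞ.apply_nonneg ⟨X.1 i j, X.2 i j⟩]
    simp [mul_assoc]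
  · exact CStarMatrix.sum_functional_nonneg τ
      (hΞ n (CStarMatrix.ofMatrix (.of fun i j => ⟨X.1 i j, X.2 i j⟩)) hX) b
  · rw [IsSelfAdjoint, CStarMatrix.star_constDiagonal, hP.star_eq]
  · rw [← CStarMatrix.constDiagonal_mul, hPP]
  · rw [CStarMatrix.constDiagonal_apply]
    split
    exacts [he, J.zero_mem]
  · ext i j
    rw [CStarMatrix.mul_constDiagonal_apply, CStarMatrix.constDiagonal_mul_apply, hPJ _ (hX i j)]

section

variable {n : ℕ} {τ : B →ₚ[ℂ] ℂ} {b : Fin n → B} (G : CStarMatrix (Fin n) (Fin n) A →ₗ[ℂ] ℂ)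

theorem mapOfFunctional_map_nonneg (hτ : τ.IsFaithful) (hcomm : ∀ x y, τ (x * y) = τ (y * x))
    (hb : ∀ x, ∑ i, τ (star (b i) * x) • b i = x) (hG : ∀ X, 0 ≤ X → 0 ≤ G X) (m : ℕ)
    (M : CStarMatrix (Fin m) (Fin m) A) (hM : 0 ≤ M) :
    0 ≤ M.map (mapOfFunctional τ b G) := by
  refine CStarMatrix.nonneg_of_forall_sum_functional_nonneg hτ fun d => ?_
  -- Traciality moves `d q * star (d p)` next to each other; Parseval then splits `τ (b j⋆ * d q * d
  -- p⋆ * b i)` into `∑ r, v r q j * star (v r p i)`.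
  let v (r : Fin n) (q : Fin m) (j : Fin n) : ℂ := τ (star (b j) * d q * b r)
  have hv (r : Fin n) (p : Fin m) (i : Fin n) : star (v r p i) =
      τ (star (b r) * star (d p) * b i) := by
    simp only [v, ← map_star, star_mul, star_star, mul_assoc]
  have e : ∑ p, ∑ q, τ (star (d p) * M.map (mapOfFunctional τ b G) p q * d q) =
      ∑ r, G (CStarMatrix.ofMatrix (.of fun i j =>
        ∑ p, ∑ q, (star (v r p i) * v r q j) • M p q)) := by
    have hr (r : Fin n) : G (CStarMatrix.ofMatrix (.of fun i j =>
        ∑ p, ∑ q, (star (v r p i) * v r q j) • M p q)) =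
        ∑ p, ∑ q, ∑ i, ∑ j, star (v r p i) * v r q j * G (CStarMatrix.singleₗ i j (M p q)) := by
      rw [← CStarMatrix.sum_singleₗ (CStarMatrix.ofMatrix _)]
      simp only [CStarMatrix.ofMatrix_apply, Matrix.of_apply, map_sum, map_smul, smul_eq_mul]
      simp only [Finset.sum_comm (s := (Finset.univ : Finset (Fin n)))
        (t := (Finset.univ : Finset (Fin m)))]
    simp only [hr]
    simp only [Finset.sum_comm (s := (Finset.univ : Finset (Fin n)))
        (t := (Finset.univ : Finset (Fin m)))]
    refine Finset.sum_congr rfl fun p _ => Finset.sum_congr rfl fun q _ => ?_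
    rw [CStarMatrix.map_apply, mul_assoc, hcomm, mul_assoc, apply_mapOfFunctional_mul G hb]
    symm
    rw [Finset.sum_comm]
    refine Finset.sum_congr rfl fun i _ => ?_
    rw [Finset.sum_comm]
    refine Finset.sum_congr rfl fun j _ => ?_
    rw [← mul_assoc (star (b j)), mul_assoc _ (star (d p)), inner_eq_sum hb, Finset.mul_sum]
    refine Finset.sum_congr rfl fun r _ => ?_
    rw [hv, mul_assoc (star (b r))]
    ring
  rw [e]
  exact Finset.sum_nonneg fun r _ => hG _ (CStarMatrix.compress_nonneg hM (v r))

end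

end CompletelyPositiveExtension

theorem mainTheorem11 {A B : Type*}
    [CStarAlgebra A] [PartialOrder A] [StarOrderedRing A] [FiniteDimensional ℂ A]
    [CStarAlgebra B] [PartialOrder B] [StarOrderedRing B] [FiniteDimensional ℂ B]
    (J : Submodule ℂ A) (hJ_sa : J.IsSelfAdjointSubspace) (hJ_pos : J.IsPositivelyGenerated)
    (Ξ : J →ₗ[ℂ] B) (hΞ : Ξ.IsCompletelyPositiveOn) :
    ∃ Φ : A →CP B, ∀ x : J, Φ (x : A) = Ξ x := by
  obtain ⟨τ, n, b, hτ, hcomm, hb, htr⟩ := exists_faithful_trace_basis B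
  obtain ⟨G, hG, hG_pos⟩ :=
    Ξ.exists_positive_extension_matrixFunctional hJ_sa hJ_pos hΞ τ b
  exact ⟨{ mapOfFunctional τ b G with
    map_cstarMatrix_nonneg' := mapOfFunctional_map_nonneg G hτ hcomm hb hG_pos },
    mapOfFunctional_eq_of_extends G hτ hb htr hG⟩
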